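/- Let $\mathcal H\neq\{0\}$ be a complex Hilbert space of finite dimension $n$, and write $\mathcal B(\mathcal H)$ for the linear operators on $\mathcal H$ and $\mathcal B(\mathcal H)\otimes\mathcal B(\mathcal H)=\mathcal B(\mathcal H\otimes\mathcal H)$. For $u\in\mathcal B(\mathcal H)\otimes\mathcal B(\mathcal H)$ let $$\pi(u)=\inf\Big\{\sum_{i}\|a_i\|\,\|b_i\|_1 : u=\sum_{i} a_i\otimes b_i \text{ (finite sum)},\ a_i,b_i\in\mathcal B(\mathcal H)\Big\},$$ where $\|\cdot\|$ is the operator norm and $\|\cdot\|_1$ the trace norm, and let $$\alpha(\varrho)=\sup_{u\neq0}\frac{|\operatorname{Tr}(\varrho u)|}{\pi(u)}$$ be the dual norm. Call $\varrho$ block-positive, $\varrho\ge_{bp}0$, if $(f\otimes g,\varrho\, f\otimes g)\ge 0$ for all $f,g\in\mathcal H$, and set $$\mathfrak D=\{\varrho:\ \alpha(\varrho)=1,\ \varrho=\varrho^*,\ \varrho\ge_{bp}0,\ \operatorname{Tr}\varrho=n\}.$$ Let $X$ be the real Banach space of self-adjoint elements of $\mathcal B(\mathcal H)\otimes\mathcal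 B(\mathcal H)$ with the norm $\alpha$. For a real normed space $Z$ and $x\in Z$ of norm one: $x$ is a *rotund point* if every $y$ of norm one with $\|\frac{x+y}{2}\|=1$ equals $x$; $x$ is a *smooth point* of the unit ball of $Z$ if there is exactly one $f\in Z^*$ with $\|f\|=1$ and $f(x)=1$; $x$ is a *strongly non-smooth point* if for every $y\ne x$ of norm one such that the segment $[x,y]$ lies in the unit sphere, $x$ is not a smooth point of the unit ball of $\operatorname{span}\{x,y\}$. A point $x$ of a set $C\subseteq Z$ is an *exposed point* of $C$ if some $f\in Z^*$ attains its maximum on $C$ at $x$ and only at $x$. 1. Let $\sigma\in X$ with $\alpha(\sigma)=1$ be a strongly non-smooth point of the unit ball of $X$ which is not a rotund point, and suppose that $\sigma\ge_{bp}0$ and $\operatorname{Tr}\sigma=n$. Then $\sigma$ is an exposed point of $\mathfrak D$ (with respect to functionals in $X^*$). 2. The set $\mathfrak D$ is isometrically isomorphic to the set of unital positive linear maps on $\mathcal B(\mathcal H)$: for every orthonormal basis of $\mathcal H$, with $b\mapsto b^t$ the corresponding transposition, there is a surjective linear isometry $\varphi\mapsto\varrho_\varphi$ from the space of linear maps $\varphi:\mathcal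 B(\mathcal H)\to\mathcal B(\mathcal H)$, normed by the operator norm induced by $\|\cdot\|$, onto $\mathcal B(\mathcal H)\otimes\mathcal B(\mathcal H)$ with the norm $\alpha$, such that $$\operatorname{Tr}\big(\varrho_\varphi\,(a\otimes b)\big)=\operatorname{Tr}\big(\varphi(a)\,b^t\big)\qquad(a,b\in\mathcal B(\mathcal H)),$$ and it maps the set of unital positive maps onto $\mathfrak D$. -/

import Mathlib

open scoped TensorProduct ComplexOrder

noncomputable section

namespace PosMaps

/-! ### Points of the unit ball of a real normed space -/

section Convex

variable {X : Type*} [NormedAddCommGroup X] [NormedSpace ℝ X]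

/-- `x` is a rotund point of the unit ball: `x` lies on the unit sphere and every unit vector `y`
with `‖(x + y) / 2‖ = 1` equals `x`. -/
def IsRotundPoint (x : X) : Prop :=
  ‖x‖ = 1 ∧ ∀ y : X, ‖y‖ = 1 → ‖(1 / 2 : ℝ) • (x + y)‖ = 1 → x = y

/-- `x` is a smooth point of the unit ball: `x` lies on the unit sphere and there is exactly one
functional `f` of norm one with `f x = 1`. -/
def IsSmoothPoint (x : X) : Prop :=
  ‖x‖ = 1 ∧ ∃! f : StrongDual ℝ X, ‖f‖ = 1 ∧ f x = 1

/-- `x` is a strongly non-smooth point of the unit ball: `x` lies on the unit sphere and for every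
unit vector `y ≠ x` such that the segment `[x, y]` is contained in the unit sphere, `x` is not a
smooth point of the unit ball of the subspace `span {x, y}`. -/
def IsStronglyNonSmoothPoint (x : X) : Prop :=
  ‖x‖ = 1 ∧ ∀ y : X, ‖y‖ = 1 → y ≠ x → segment ℝ x y ⊆ Metric.sphere (0 : X) 1 →
    ¬ IsSmoothPoint
      (⟨x, Submodule.subset_span (Set.mem_insert x {y})⟩ : Submodule.span ℝ ({x, y} : Set X))

end Convex

/-! ### The projective norm `π` and its dual norm `α` on `B(H) ⊗ B(H) = B(H ⊗ H)` -/

section Norms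

variable {H : Type*} [NormedAddCommGroup H] [InnerProductSpace ℂ H] [FiniteDimensional ℂ H]

/-- The trace norm `‖b‖₁ = Tr |b|`, the sum of the singular values of `b`. -/
def traceNorm (b : H →L[ℂ] H) : ℝ :=
  ∑ i ∈ Finset.range (Module.finrank ℂ H), (b : H →ₗ[ℂ] H).singularValues i

/-- The operator `a ⊗ b` on `H ⊗ H`. -/
def opTensor (a b : H →L[ℂ] H) : Module.End ℂ (H ⊗[ℂ] H) :=
  TensorProduct.map (a : H →ₗ[ℂ] H) (b : H →ₗ[ℂ] H)

/-- The values `∑ᵢ ‖xᵢ‖ ‖yᵢ‖₁` over all finite representations `u = ∑ᵢ xᵢ ⊗ yᵢ`. -/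
def repValues (u : Module.End ℂ (H ⊗[ℂ] H)) : Set ℝ :=
  {r | ∃ (k : ℕ) (x y : Fin k → (H →L[ℂ] H)),
    u = ∑ i, opTensor (x i) (y i) ∧ r = ∑ i, ‖x i‖ * traceNorm (y i)}

/-- The projective norm on `B(H) ⊗ B(H)`, where the first factor carries the operator norm and
the second factor carries the trace norm. -/
def projNorm (u : Module.End ℂ (H ⊗[ℂ] H)) : ℝ := sInf (repValues u)

/-- The norm dual to the projective norm with respect to the pairing `Tr (ϱ a)`. -/
def alphaNorm (ϱ : Module.End ℂ (H ⊗[ℂ] H)) : ℝ :=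
  sSup {r | ∃ a : Module.End ℂ (H ⊗[ℂ] H), a ≠ 0 ∧
    r = ‖LinearMap.trace ℂ (H ⊗[ℂ] H) (ϱ * a)‖ / projNorm a}

/-! Helper facts: `alphaNorm` is a norm. -/

theorem traceNorm_nonneg (b : H →L[ℂ] H) : 0 ≤ traceNorm b :=
  Finset.sum_nonneg fun i _ => LinearMap.singularValues_nonneg _ i

theorem norm_le_traceNorm (b : H →L[ℂ] H) : ‖b‖ ≤ traceNorm b := by
  refine ContinuousLinearMap.opNorm_le_bound _ (traceNorm_nonneg b) fun v => ?_
  set T : H →ₗ[ℂ] H := (b : H →ₗ[ℂ] H) with hT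
  have hS := T.isSymmetric_adjoint_comp_self
  set e := hS.eigenvectorBasis rfl with he
  have key : ‖b v‖ ^ 2 = ∑ i : Fin (Module.finrank ℂ H), T.singularValues i ^ 2 * ‖inner ℂ (e i) v‖ ^ 2 := by
    have h1 : ((‖b v‖ ^ 2 : ℝ) : ℂ) = inner ℂ v ((T.adjoint ∘ₗ T) v) := by
      rw [LinearMap.comp_apply, LinearMap.adjoint_inner_right]
      have := inner_self_eq_norm_sq_to_K (𝕜 := ℂ) (b v)
      push_cast
      exact this.symm
    have h2 : inner ℂ v ((T.adjoint ∘ₗ T) v) =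
        ((∑ i : Fin (Module.finrank ℂ H), T.singularValues i ^ 2 * ‖inner ℂ (e i) v‖ ^ 2 : ℝ) : ℂ) := by
      rw [← e.sum_inner_mul_inner v ((T.adjoint ∘ₗ T) v)]
      push_cast
      refine Finset.sum_congr rfl fun i _ => ?_
      have h5 : inner ℂ (e i) ((T.adjoint ∘ₗ T) v) =
          (hS.eigenvalues rfl i : ℂ) * inner ℂ (e i) v := by
        rw [← hS (e i) v, he, hS.apply_eigenvectorBasis, inner_smul_left]
        congr 1
        exact Complex.conj_ofReal _
      have h6 : ((hS.eigenvalues rfl i : ℝ) : ℂ) = (T.singularValues i : ℂ) ^ 2 := by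
        have := T.sq_singularValues_fin rfl i
        exact_mod_cast this.symm
      have h4 := RCLike.conj_mul (inner ℂ (e i) v)
      refine (congrArg (inner ℂ v (e i) * ·) h5).trans ?_
      rw [h6, mul_left_comm, ← inner_conj_symm v (e i), h4]
      rfl
    have := h1.trans h2
    exact_mod_cast this
  have hle : ‖b v‖ ^ 2 ≤ (traceNorm b * ‖v‖) ^ 2 := by
    rw [key, mul_pow, ← e.sum_sq_norm_inner_right v, Finset.mul_sum]
    refine Finset.sum_le_sum fun i _ => mul_le_mul_of_nonneg_right ?_ (by positivity)
    refine pow_le_pow_left₀ (T.singularValues_nonneg i) ?_ 2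
    exact Finset.single_le_sum (f := fun j => T.singularValues j)
      (fun j _ => T.singularValues_nonneg j) (Finset.mem_range.2 i.2)
  exact abs_le_of_sq_le_sq' hle (mul_nonneg (traceNorm_nonneg b) (norm_nonneg v)) |>.2

theorem repValues_nonneg {u : Module.End ℂ (H ⊗[ℂ] H)} {r : ℝ} (hr : r ∈ repValues u) :
    0 ≤ r := by
  obtain ⟨k, x, y, -, rfl⟩ := hr
  exact Finset.sum_nonneg fun i _ => mul_nonneg (norm_nonneg _) (traceNorm_nonneg _)

theorem projNorm_nonneg (u : Module.End ℂ (H ⊗[ℂ] H)) : 0 ≤ projNorm u :=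
  Real.sInf_nonneg fun _ hr => repValues_nonneg hr

theorem repValues_nonempty (u : Module.End ℂ (H ⊗[ℂ] H)) : (repValues u).Nonempty := by
  obtain ⟨t, rfl⟩ := (homTensorHomEquiv ℂ H H H H).surjective u
  obtain ⟨k, s, hs⟩ : ∃ (k : ℕ) (s : Fin k → (H →ₗ[ℂ] H) × (H →ₗ[ℂ] H)),
      t = ∑ i, (s i).1 ⊗ₜ (s i).2 := by
    obtain ⟨S, hS⟩ := TensorProduct.exists_finset t
    refine ⟨S.card, fun i => (S.equivFin.symm i : (H →ₗ[ℂ] H) × (H →ₗ[ℂ] H)), ?_⟩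
    rw [hS, ← Finset.sum_coe_sort]
    exact (S.equivFin.symm.sum_comp
      (fun i : S => (i : (H →ₗ[ℂ] H) × (H →ₗ[ℂ] H)).1 ⊗ₜ[ℂ]
        (i : (H →ₗ[ℂ] H) × (H →ₗ[ℂ] H)).2)).symm
  refine ⟨_, k, fun i => LinearMap.toContinuousLinearMap (s i).1,
    fun i => LinearMap.toContinuousLinearMap (s i).2, ?_, rfl⟩
  rw [hs, map_sum]
  refine Finset.sum_congr rfl fun i _ => ?_
  rw [homTensorHomEquiv_apply, TensorProduct.homTensorHomMap_apply]
  rfl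

set_option maxSynthPendingDepth 3 in
theorem exists_norm_trace_le (ϱ : Module.End ℂ (H ⊗[ℂ] H)) :
    ∃ C : ℝ, ∀ a, ‖LinearMap.trace ℂ (H ⊗[ℂ] H) (ϱ * a)‖ ≤ C * projNorm a := by
  let B : (H →L[ℂ] H) →ₗ[ℂ] (H →L[ℂ] H) →ₗ[ℂ] ℂ :=
    LinearMap.mk₂ ℂ (fun x y => LinearMap.trace ℂ (H ⊗[ℂ] H) (ϱ * opTensor x y))
      (fun x x' y => by simp [opTensor, TensorProduct.map_add_left, mul_add])
      (fun c x y => by simp [opTensor, TensorProduct.map_smul_left])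
      (fun x y y' => by simp [opTensor, TensorProduct.map_add_right, mul_add])
      (fun c x y => by simp [opTensor, TensorProduct.map_smul_right])
  set B' := B.toContinuousBilinearMap
  have hB : ∀ x y, ‖LinearMap.trace ℂ (H ⊗[ℂ] H) (ϱ * opTensor x y)‖ ≤
      ‖B'‖ * (‖x‖ * traceNorm y) := fun x y => by
    have := B'.le_opNorm₂ x y
    refine this.trans ?_
    rw [mul_assoc]
    gcongr
    exact norm_le_traceNorm y
  refine ⟨‖B'‖, fun a => ?_⟩
  have hr : ∀ r ∈ repValues a, ‖LinearMap.trace ℂ (H ⊗[ℂ] H) (ϱ * a)‖ ≤ ‖B'‖ * r := by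
    rintro r ⟨k, x, y, rfl, rfl⟩
    rw [Finset.mul_sum, Finset.mul_sum, map_sum]
    exact (norm_sum_le _ _).trans (Finset.sum_le_sum fun i _ => hB _ _)
  rcases (norm_nonneg B').eq_or_lt with h0 | h0
  · obtain ⟨r, hra⟩ := repValues_nonempty a
    simpa [← h0] using hr r hra
  · rw [← div_le_iff₀' h0]
    exact le_csInf (repValues_nonempty a) fun r hra => (div_le_iff₀' h0).2 (hr r hra)

theorem alphaNorm_bddAbove (ϱ : Module.End ℂ (H ⊗[ℂ] H)) :
    BddAbove {r | ∃ a : Module.End ℂ (H ⊗[ℂ] H), a ≠ 0 ∧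
      r = ‖LinearMap.trace ℂ (H ⊗[ℂ] H) (ϱ * a)‖ / projNorm a} := by
  obtain ⟨C, hC⟩ := exists_norm_trace_le ϱ
  refine ⟨max C 0, ?_⟩
  rintro r ⟨a, -, rfl⟩
  exact div_le_of_le_mul₀ (projNorm_nonneg a) (le_max_right _ _)
    ((hC a).trans (mul_le_mul_of_nonneg_right (le_max_left _ _) (projNorm_nonneg a)))

theorem alphaNorm_nonneg (ϱ : Module.End ℂ (H ⊗[ℂ] H)) : 0 ≤ alphaNorm ϱ := by
  refine Real.sSup_nonneg ?_
  rintro r ⟨a, -, rfl⟩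
  exact div_nonneg (norm_nonneg _) (projNorm_nonneg a)

theorem norm_trace_le (ϱ a : Module.End ℂ (H ⊗[ℂ] H)) :
    ‖LinearMap.trace ℂ (H ⊗[ℂ] H) (ϱ * a)‖ ≤ alphaNorm ϱ * projNorm a := by
  by_cases ha : a = 0
  · subst ha
    simpa using mul_nonneg (alphaNorm_nonneg ϱ) (projNorm_nonneg 0)
  rcases (projNorm_nonneg a).eq_or_lt with h0 | h0
  · obtain ⟨C, hC⟩ := exists_norm_trace_le ϱ
    simpa [← h0] using hC a
  · rw [← div_le_iff₀ h0]
    exact le_csSup (alphaNorm_bddAbove ϱ) ⟨a, ha, rfl⟩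

theorem alphaNorm_le {ϱ : Module.End ℂ (H ⊗[ℂ] H)} {C : ℝ} (hC0 : 0 ≤ C)
    (hC : ∀ a, ‖LinearMap.trace ℂ (H ⊗[ℂ] H) (ϱ * a)‖ ≤ C * projNorm a) : alphaNorm ϱ ≤ C := by
  refine Real.sSup_le ?_ hC0
  rintro r ⟨a, -, rfl⟩
  exact div_le_of_le_mul₀ (projNorm_nonneg a) hC0 (hC a)

theorem alphaNorm_add_le (ϱ σ : Module.End ℂ (H ⊗[ℂ] H)) :
    alphaNorm (ϱ + σ) ≤ alphaNorm ϱ + alphaNorm σ := by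
  refine alphaNorm_le (add_nonneg (alphaNorm_nonneg ϱ) (alphaNorm_nonneg σ)) fun a => ?_
  rw [add_mul, map_add, add_mul]
  exact (norm_add_le _ _).trans (add_le_add (norm_trace_le ϱ a) (norm_trace_le σ a))

theorem alphaNorm_smul_le (c : ℂ) (ϱ : Module.End ℂ (H ⊗[ℂ] H)) :
    alphaNorm (c • ϱ) ≤ ‖c‖ * alphaNorm ϱ := by
  refine alphaNorm_le (mul_nonneg (norm_nonneg c) (alphaNorm_nonneg ϱ)) fun a => ?_
  rw [smul_mul_assoc, map_smul, norm_smul, mul_assoc]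
  exact mul_le_mul_of_nonneg_left (norm_trace_le ϱ a) (norm_nonneg c)

theorem alphaNorm_smul (c : ℂ) (ϱ : Module.End ℂ (H ⊗[ℂ] H)) :
    alphaNorm (c • ϱ) = ‖c‖ * alphaNorm ϱ := by
  refine le_antisymm (alphaNorm_smul_le c ϱ) ?_
  by_cases hc : c = 0
  · subst hc
    simpa using alphaNorm_nonneg _
  have h := alphaNorm_smul_le c⁻¹ (c • ϱ)
  rwa [smul_smul, inv_mul_cancel₀ hc, one_smul, norm_inv,
    le_inv_mul_iff₀ (norm_pos_iff.2 hc)] at h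

theorem eq_zero_of_alphaNorm_eq_zero {ϱ : Module.End ℂ (H ⊗[ℂ] H)} (h : alphaNorm ϱ = 0) :
    ϱ = 0 := by
  have h1 : LinearMap.trace ℂ (H ⊗[ℂ] H) (ϱ * ϱ.adjoint) = 0 := by
    simpa [h] using norm_trace_le ϱ ϱ.adjoint
  rw [LinearMap.trace_mul_comm,
    LinearMap.trace_eq_sum_inner _ (stdOrthonormalBasis ℂ (H ⊗[ℂ] H))] at h1
  simp only [Module.End.mul_apply, LinearMap.adjoint_inner_right, inner_self_eq_norm_sq_to_K] at h1
  have h2 : ∑ i, ‖ϱ (stdOrthonormalBasis ℂ (H ⊗[ℂ] H) i)‖ ^ 2 = 0 := by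
    have h3 : ((∑ i, ‖ϱ (stdOrthonormalBasis ℂ (H ⊗[ℂ] H) i)‖ ^ 2 : ℝ) : ℂ) = 0 := by
      push_cast
      exact h1
    exact_mod_cast h3
  rw [Finset.sum_eq_zero_iff_of_nonneg (fun i _ => by positivity)] at h2
  refine (stdOrthonormalBasis ℂ (H ⊗[ℂ] H)).toBasis.ext fun i => ?_
  simpa using h2 i (Finset.mem_univ i)

end Norms

/-! ### The normed space `B(H) ⊗_α B(H)` and the set `𝔇` -/

/-- `B(H) ⊗_α B(H)`: the operators on `H ⊗ H` with the norm `α`. -/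
def AlphaTensor (H : Type*) [NormedAddCommGroup H] [InnerProductSpace ℂ H] : Type _ :=
  Module.End ℂ (H ⊗[ℂ] H)

section Spaces

variable (H : Type*) [NormedAddCommGroup H] [InnerProductSpace ℂ H]

instance : AddCommGroup (AlphaTensor H) :=
  inferInstanceAs (AddCommGroup (Module.End ℂ (H ⊗[ℂ] H)))

instance : Module ℂ (AlphaTensor H) :=
  inferInstanceAs (Module ℂ (Module.End ℂ (H ⊗[ℂ] H)))

variable {H} in
/-- An element of `B(H) ⊗_α B(H)` as an operator on `H ⊗ H`. -/
def AlphaTensor.toEnd (ϱ : AlphaTensor H) : Module.End ℂ (H ⊗[ℂ] H) := ϱ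

variable [FiniteDimensional ℂ H]

instance : Norm (AlphaTensor H) := ⟨fun ϱ => alphaNorm ϱ.toEnd⟩

theorem AlphaTensor.core : NormedSpace.Core ℂ (AlphaTensor H) where
  norm_nonneg ϱ := alphaNorm_nonneg ϱ.toEnd
  norm_smul c ϱ := alphaNorm_smul c ϱ.toEnd
  norm_triangle ϱ σ := alphaNorm_add_le ϱ.toEnd σ.toEnd
  norm_eq_zero_iff ϱ := by
    refine ⟨fun h => eq_zero_of_alphaNorm_eq_zero (ϱ := ϱ.toEnd) h, ?_⟩
    rintro rfl
    have h := alphaNorm_smul (0 : ℂ) (0 : Module.End ℂ (H ⊗[ℂ] H))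
    rw [zero_smul, norm_zero, zero_mul] at h
    exact h

instance : NormedAddCommGroup (AlphaTensor H) := NormedAddCommGroup.ofCore (AlphaTensor.core H)

instance : NormedSpace ℂ (AlphaTensor H) := NormedSpace.ofCore (AlphaTensor.core H)

/-- The real normed space of self-adjoint elements of `B(H) ⊗_α B(H)`. -/
def alphaSelfAdjoint : Submodule ℝ (AlphaTensor H) where
  carrier := {ϱ | ϱ.toEnd.adjoint = ϱ.toEnd}
  add_mem' {ϱ σ} h h' := by
    have : (ϱ.toEnd + σ.toEnd).adjoint = ϱ.toEnd + σ.toEnd := by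
      rw [map_add]
      exact congrArg₂ (· + ·) h h'
    exact this
  zero_mem' := map_zero (LinearMap.adjoint (𝕜 := ℂ) (E := H ⊗[ℂ] H) (F := H ⊗[ℂ] H))
  smul_mem' c ϱ h := by
    have : ((c : ℂ) • ϱ.toEnd).adjoint = (c : ℂ) • ϱ.toEnd := by
      rw [LinearEquiv.map_smulₛₗ, Complex.conj_ofReal]
      exact congrArg ((c : ℂ) • ·) h
    exact this

variable {H}

/-- `ϱ` is block-positive: `(f ⊗ g, ϱ (f ⊗ g)) ≥ 0` for all `f`, `g` in `H`. -/
def IsBlockPositive (ϱ : AlphaTensor H) : Prop :=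
  ∀ f g : H, 0 ≤ inner ℂ (f ⊗ₜ[ℂ] g) (ϱ.toEnd (f ⊗ₜ[ℂ] g))

/-- The trace of `ϱ` as an operator on `H ⊗ H`. -/
def tr (ϱ : AlphaTensor H) : ℂ := LinearMap.trace ℂ (H ⊗[ℂ] H) ϱ.toEnd

variable (H) in
/-- The set `𝔇` of normalized block-positive density matrices. -/
def normalizedBP : Set (AlphaTensor H) :=
  {ϱ | ‖ϱ‖ = 1 ∧ ϱ.toEnd.adjoint = ϱ.toEnd ∧ IsBlockPositive ϱ ∧ tr ϱ = Module.finrank ℂ H}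

variable (H) in
/-- The set of unital positive linear maps `B(H) → B(H)`. -/
def unitalPositiveMaps : Set ((H →L[ℂ] H) →L[ℂ] (H →L[ℂ] H)) :=
  {φ | (∀ a : H →L[ℂ] H, a.IsPositive → (φ a).IsPositive) ∧ φ 1 = 1}

/-- The transpose of an operator with respect to an orthonormal basis. -/
def transposeOp {ι : Type*} [Fintype ι] [DecidableEq ι] (e : OrthonormalBasis ι ℂ H)
    (b : H →L[ℂ] H) : H →ₗ[ℂ] H :=
  Matrix.toLin e.toBasis e.toBasis
    (LinearMap.toMatrix e.toBasis e.toBasis (b : H →ₗ[ℂ] H)).transpose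

end Spaces

end PosMaps

end

open PosMaps

/-!
The correspondence. With `Eᵢⱼ` the matrix units of the basis `e`, a map `φ` is sent to
`ϱ = ∑ i j, Eⱼᵢ ⊗ φ(Eᵢⱼ)ᵗ`, which satisfies `Tr (ϱ (a ⊗ b)) = Tr (φ(a) bᵗ)`
(`trace_density_mul`). Since the trace norm is dual to the operator norm and invariant under
transposition, `α(ϱ) = ‖φ‖` (`norm_density`); an injective linear map between spaces of dimension
`n⁴` is surjective. All facts about the trace norm come from the singular value decomposition
(`exists_orthonormalBasis_apply_eq_singularValues_smul`).

Evaluating at rank-one projections gives `(f ⊗ g, ϱ f ⊗ g) = (ḡ, φ(|f⟩⟨f|) ḡ)`, so `ϱ` is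
block-positive exactly when `φ` is positive (`isBlockPositive_density_iff`), and then `ϱ` is
self-adjoint (`IsBlockPositive.adjoint_eq`). Moreover `Tr ϱ = Tr φ(1)`. A positive unital map has
norm one (`norm_le_one_of_mem_unitalPositiveMaps`): a contraction is the mean of two unitaries, and
on a unitary `∑ z • P z` the Cauchy–Schwarz inequality applies to each of the positive operators
`φ (P z)`, which sum to one. Conversely, if `‖φ‖ = 1` and `Tr φ(1) = n`, then `φ(1)` is a positive
contraction of trace `n`, hence the identity.

Exposed points. In a finite-dimensional normed space some functional supporting the unit ball at
`x` attains its maximum on the ball only where all functionals supporting the ball at `x` do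
(`exists_supporting_functional`). If this happened at some `y ≠ x`, the segment `[x, y]` would lie
in the sphere and, by Hahn–Banach, `x` would be a smooth point of the unit ball of `span {x, y}`.
Thus a strongly non-smooth point is an exposed point of the unit ball
(`IsStronglyNonSmoothPoint.exists_exposing`), and a fortiori of every subset of the ball that
contains it, such as `𝔇`.
-/

namespace PosMaps

open InnerProductSpace Module

/-! ### Strongly non-smooth points are exposed -/

section Exposed

variable {X : Type*} [NormedAddCommGroup X] [NormedSpace ℝ X]

/-- In a finite-dimensional space the norm-one functionals supporting the unit ball at `x` can be
replaced by a single one: their average over a finite spanning set attains the value one at a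
point `y` of the ball only if every supporting functional at `x` does. -/
theorem exists_supporting_functional [FiniteDimensional ℝ X] {x : X} (hx : ‖x‖ = 1) :
    ∃ l : StrongDual ℝ X, l x = 1 ∧ (∀ y : X, ‖y‖ ≤ 1 → l y ≤ 1) ∧
      ∀ y : X, ‖y‖ ≤ 1 → l y = 1 → ∀ f : StrongDual ℝ X, ‖f‖ = 1 → f x = 1 → f y = 1 := by
  set J : Set (StrongDual ℝ X) := {f | ‖f‖ = 1 ∧ f x = 1}
  have hle : ∀ f ∈ J, ∀ y : X, ‖y‖ ≤ 1 → f y ≤ 1 := fun f hf y hy =>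
    (le_abs_self _).trans ((f.le_opNorm y).trans (by rw [hf.1, one_mul]; exact hy))
  obtain ⟨g, hg1, hg2⟩ := exists_dual_vector ℝ x (by simp [hx])
  have hg : g ∈ J := ⟨hg1, by simpa [hx] using hg2⟩
  obtain ⟨t, htJ, -, hspan, -⟩ := Submodule.exists_finset_span_eq_linearIndepOn ℝ J
  have hne : t.Nonempty := by
    rw [Finset.nonempty_iff_ne_empty]
    rintro rfl
    have : g ∈ Submodule.span ℝ ((∅ : Finset (StrongDual ℝ X)) : Set (StrongDual ℝ X)) :=
      hspan ▸ Submodule.subset_span hg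
    simp only [Finset.coe_empty, Submodule.span_empty, Submodule.mem_bot] at this
    simp [this] at hg1
  have hcard : (0 : ℝ) < t.card := by exact_mod_cast hne.card_pos
  have hl : ∀ y, ((t.card : ℝ)⁻¹ • ∑ f ∈ t, f) y = (t.card : ℝ)⁻¹ * ∑ f ∈ t, f y := fun y => by
    simp
  have hsum : ∀ y : X, ‖y‖ ≤ 1 → ∑ f ∈ t, f y ≤ t.card := fun y hy => by
    simpa using Finset.sum_le_sum fun f hf => hle f (htJ hf) y hy
  refine ⟨(t.card : ℝ)⁻¹ • ∑ f ∈ t, f, ?_, fun y hy => ?_, fun y hy hly f hf1 hf2 => ?_⟩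
  · rw [hl, Finset.sum_congr rfl fun f hf => (htJ hf).2]
    simp [hcard.ne']
  · rw [hl, inv_mul_le_iff₀ hcard, mul_one]
    exact hsum y hy
  · rw [hl, inv_mul_eq_iff_eq_mul₀ hcard.ne', mul_one] at hly
    have hall : ∀ h ∈ t, h y = 1 := by
      refine (Finset.sum_eq_sum_iff_of_le fun h hh => hle h (htJ hh) y hy).1 ?_
      simpa using hly
    -- the functionals vanishing at `y - x` form a subspace, which contains `t` and hence `J`
    have hvan : ∀ h ∈ Submodule.span ℝ J, h (y - x) = 0 := by
      rw [← hspan]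
      intro h hh
      induction hh using Submodule.span_induction with
      | mem h hh => rw [map_sub, hall h hh, (htJ hh).2, sub_self]
      | zero => simp
      | add a b _ _ ha hb => simp [ha, hb]
      | smul c a _ ha => simp [ha]
    have := hvan f (Submodule.subset_span ⟨hf1, hf2⟩)
    rw [map_sub, hf2] at this
    linarith

/-- A strongly non-smooth point of a finite-dimensional unit ball is exposed: if all functionals
supporting the ball at `x` took the value one at some `y ≠ x` of the ball, they would agree on
`span {x, y}`, and by Hahn–Banach `x` would be a smooth point of the unit ball of that plane. -/
theorem IsStronglyNonSmoothPoint.exists_exposing [FiniteDimensional ℝ X] {x : X}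
    (hx : IsStronglyNonSmoothPoint x) :
    ∃ l : StrongDual ℝ X, l x = 1 ∧ ∀ y : X, ‖y‖ ≤ 1 → l y ≤ 1 ∧ (l y = 1 → y = x) := by
  obtain ⟨l, hlx, hle, huniq⟩ := exists_supporting_functional hx.1
  refine ⟨l, hlx, fun y hy => ⟨hle y hy, fun hly => ?_⟩⟩
  by_contra hne
  -- every functional supporting the ball at `x` also supports it at `y`
  have hJ := huniq y hy hly
  obtain ⟨g, hg1, hg2⟩ := exists_dual_vector ℝ x (by simp [hx.1])
  replace hg2 : g x = 1 := by simpa [hx.1] using hg2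
  have hgy := hJ g hg1 hg2
  have hnorm : ∀ z : X, g z = 1 → 1 ≤ ‖z‖ := fun z hz => by
    simpa [hz, hg1] using g.le_opNorm z
  have hseg : segment ℝ x y ⊆ Metric.sphere (0 : X) 1 := by
    rintro _ ⟨a, b, ha, hb, hab, rfl⟩
    rw [mem_sphere_zero_iff_norm]
    refine le_antisymm ?_ (hnorm _ (by simp [hg2, hgy, hab]))
    have : (a • x + b • y) ∈ Metric.closedBall (0 : X) 1 :=
      convex_closedBall (0 : X) 1 (by simp [hx.1]) (by simpa using hy) ha hb hab
    simpa using this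
  refine hx.2 y (le_antisymm hy (hnorm y hgy)) hne hseg ?_
  set P : Submodule ℝ X := Submodule.span ℝ {x, y}
  set x' : P := ⟨x, Submodule.subset_span (Set.mem_insert x {y})⟩
  have hx' : ‖x'‖ = 1 := hx.1
  obtain ⟨f, hf1, hf2⟩ := exists_dual_vector ℝ x' (by simp [hx'])
  replace hf2 : f x' = 1 := by simpa [hx'] using hf2
  -- a supporting functional on the plane extends with the same norm, so its value at `y` is one
  have hext : ∀ h : StrongDual ℝ P, ‖h‖ = 1 → h x' = 1 →
      ∀ (a b : ℝ) (z : P), (z : X) = a • x + b • y → h z = a + b := by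
    intro h h1 h2 a b z hz
    obtain ⟨k, hk, hkn⟩ := exists_extension_norm_eq P h
    have hkx : k x = 1 := (hk x').trans h2
    rw [← hk z, hz, map_add, map_smul, map_smul, hkx, hJ k (hkn.trans h1) hkx]
    simp
  refine ⟨hx', f, ⟨hf1, hf2⟩, fun h ⟨h1, h2⟩ => ?_⟩
  ext z
  obtain ⟨a, b, hz⟩ := Submodule.mem_span_pair.1 z.2
  rw [hext h h1 h2 a b z hz.symm, hext f hf1 hf2 a b z hz.symm]

end Exposed

/-! ### Singular value decomposition and the trace norm -/

section TraceNorm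

variable {H : Type*} [NormedAddCommGroup H] [InnerProductSpace ℂ H] [FiniteDimensional ℂ H]

/-- Singular value decomposition: `b` maps an orthonormal basis to the multiples of another
orthonormal basis by its singular values. -/
theorem exists_orthonormalBasis_apply_eq_singularValues_smul (b : H →L[ℂ] H) :
    ∃ u v : OrthonormalBasis (Fin (finrank ℂ H)) ℂ H,
      ∀ i, b (v i) = (((b : H →ₗ[ℂ] H).singularValues i : ℝ) : ℂ) • u i := by
  set T : H →ₗ[ℂ] H := (b : H →ₗ[ℂ] H) with hT
  have hS := T.isSymmetric_adjoint_comp_self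
  set v := hS.eigenvectorBasis rfl with hv
  have hinner : ∀ i j, inner ℂ (b (v i)) (b (v j)) =
      if i = j then ((T.singularValues i : ℝ) : ℂ) ^ 2 else 0 := by
    intro i j
    have h1 : inner ℂ (b (v i)) (b (v j)) = inner ℂ (v i) ((T.adjoint ∘ₗ T) (v j)) := by
      rw [LinearMap.comp_apply, LinearMap.adjoint_inner_right]
      rfl
    have h2 : ((hS.eigenvalues rfl j : ℝ) : ℂ) = (T.singularValues j : ℂ) ^ 2 := by
      exact_mod_cast (T.sq_singularValues_fin rfl j).symm
    have h3 : (T.adjoint ∘ₗ T) (v j) = ((T.singularValues j : ℝ) : ℂ) ^ 2 • v j := by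
      rw [← h2]
      exact hS.apply_eigenvectorBasis rfl j
    rw [h1, h3, inner_smul_right, orthonormal_iff_ite.1 v.orthonormal i j]
    split_ifs with hij
    · rw [hij, mul_one]
    · rw [mul_zero]
  -- the normalized images of the `v i` with nonzero singular value are orthonormal; they are
  -- completed to a basis arbitrarily, since `b (v i) = 0` for the other indices
  obtain ⟨u, hu⟩ := Orthonormal.exists_orthonormalBasis_extension_of_card_eq (𝕜 := ℂ)
    (v := fun i : Fin (finrank ℂ H) => ((T.singularValues i : ℝ) : ℂ)⁻¹ • b (v i))
    (s := {i : Fin (finrank ℂ H) | T.singularValues i ≠ 0}) (by simp) (by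
      rw [orthonormal_iff_ite]
      rintro ⟨i, hi⟩ ⟨j, hj⟩
      have hi' : ((T.singularValues i : ℝ) : ℂ) ≠ 0 := by exact_mod_cast hi
      simp only [Set.domRestrict_apply, inner_smul_left, inner_smul_right, hinner, map_inv₀,
        Complex.conj_ofReal, Subtype.mk.injEq]
      split_ifs with hij
      · subst hij
        field_simp
      · simp)
  refine ⟨u, v, fun i => ?_⟩
  by_cases hi : T.singularValues i = 0
  · have := hinner i i
    rw [if_pos rfl, hi] at this
    simpa [hi] using this
  · rw [hu i hi, smul_smul, mul_inv_cancel₀ (by exact_mod_cast hi), one_smul]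

theorem traceNorm_eq_sum_fin (b : H →L[ℂ] H) :
    traceNorm b = ∑ i : Fin (finrank ℂ H), (b : H →ₗ[ℂ] H).singularValues i :=
  Finset.sum_range _

theorem eq_sum_rankOne {H : Type*} [NormedAddCommGroup H] [InnerProductSpace ℂ H]
    {ι : Type*} [Fintype ι] (v : OrthonormalBasis ι ℂ H) (b : H →L[ℂ] H) :
    b = ∑ i, rankOne ℂ (b (v i)) (v i) := by
  conv_lhs => rw [← ContinuousLinearMap.comp_id b, ← v.sum_rankOne_eq_id]
  ext z
  simp

theorem trace_rankOne_comp (x : H →L[ℂ] H) (f g : H) :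
    LinearMap.trace ℂ H ((x : H →ₗ[ℂ] H) ∘ₗ (rankOne ℂ f g : H →L[ℂ] H)) = inner ℂ g (x f) := by
  rw [← ContinuousLinearMap.toLinearMap_comp, comp_rankOne, trace_rankOne]

/-- One half of the duality between the operator norm and the trace norm. -/
theorem norm_trace_comp_le (x b : H →L[ℂ] H) :
    ‖LinearMap.trace ℂ H ((x : H →ₗ[ℂ] H) ∘ₗ (b : H →ₗ[ℂ] H))‖ ≤ ‖x‖ * traceNorm b := by
  obtain ⟨u, v, h⟩ := exists_orthonormalBasis_apply_eq_singularValues_smul b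
  rw [LinearMap.trace_eq_sum_inner _ v, traceNorm_eq_sum_fin, Finset.mul_sum]
  refine (norm_sum_le _ _).trans (Finset.sum_le_sum fun i _ => (norm_inner_le_norm _ _).trans ?_)
  have hbi : ((x : H →ₗ[ℂ] H) ∘ₗ (b : H →ₗ[ℂ] H)) (v i) = x (b (v i)) := rfl
  rw [hbi, v.norm_eq_one, one_mul]
  refine (x.le_opNorm _).trans (mul_le_mul_of_nonneg_left ?_ (norm_nonneg x))
  rw [h, norm_smul, u.norm_eq_one, mul_one, Complex.norm_real, Real.norm_eq_abs,
    abs_of_nonneg (LinearMap.singularValues_nonneg _ _)]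

/-- The trace norm is attained by pairing with the unitary that takes the left singular vectors
to the right ones. -/
theorem traceNorm_sum_rankOne_le {κ : Type*} (s : Finset κ) (f g : κ → H) :
    traceNorm (∑ k ∈ s, rankOne ℂ (f k) (g k)) ≤ ∑ k ∈ s, ‖f k‖ * ‖g k‖ := by
  set b : H →L[ℂ] H := ∑ k ∈ s, rankOne ℂ (f k) (g k) with hb
  obtain ⟨u, v, h⟩ := exists_orthonormalBasis_apply_eq_singularValues_smul b
  set w : H ≃ₗᵢ[ℂ] H := u.equiv v (Equiv.refl _)
  set w' : H →L[ℂ] H := w.toContinuousLinearEquiv.toContinuousLinearMap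
  have hw : ∀ z, w' z = w z := fun _ => rfl
  have h1 : LinearMap.trace ℂ H ((w' : H →ₗ[ℂ] H) ∘ₗ (b : H →ₗ[ℂ] H)) = (traceNorm b : ℂ) := by
    rw [LinearMap.trace_eq_sum_inner _ v, traceNorm_eq_sum_fin, Complex.ofReal_sum]
    refine Finset.sum_congr rfl fun i _ => ?_
    have hbi : ((w' : H →ₗ[ℂ] H) ∘ₗ (b : H →ₗ[ℂ] H)) (v i) = w (b (v i)) := rfl
    rw [hbi, h, map_smul, inner_smul_right, OrthonormalBasis.equiv_apply_basis]
    simp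
  have h2 : LinearMap.trace ℂ H ((w' : H →ₗ[ℂ] H) ∘ₗ (b : H →ₗ[ℂ] H)) =
      ∑ k ∈ s, inner ℂ (g k) (w (f k)) := by
    rw [hb, ContinuousLinearMap.toLinearMap_sum, ← Module.End.mul_eq_comp, Finset.mul_sum,
      map_sum]
    exact Finset.sum_congr rfl fun k _ => trace_rankOne_comp w' (f k) (g k)
  calc traceNorm b = ‖(traceNorm b : ℂ)‖ := by
        rw [Complex.norm_real, Real.norm_eq_abs, abs_of_nonneg (traceNorm_nonneg b)]
    _ ≤ ∑ k ∈ s, ‖f k‖ * ‖g k‖ := by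
        rw [← h1, h2]
        refine (norm_sum_le _ _).trans (Finset.sum_le_sum fun k _ => ?_)
        refine (norm_inner_le_norm _ _).trans_eq ?_
        rw [w.norm_map, mul_comm]

end TraceNorm

/-! ### Positive unital maps are contractions -/

section RussoDye

variable {H : Type*} [NormedAddCommGroup H] [InnerProductSpace ℂ H] [FiniteDimensional ℂ H]

/-- The Cauchy–Schwarz inequality for a positive form, with the geometric mean replaced by the
arithmetic one, so that it can be summed over several positive operators. -/
theorem two_mul_norm_inner_le_of_isPositive {A : H →L[ℂ] H} (hA : A.IsPositive) (f g : H) :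
    2 * ‖inner ℂ f (A g)‖ ≤ A.reApplyInnerSelf f + A.reApplyInnerSelf g := by
  obtain ⟨m, u, rfl⟩ := ContinuousLinearMap.isPositive_iff_eq_sum_rankOne.1 hA
  have hre : ∀ z, (∑ i, rankOne ℂ (u i) (u i) : H →L[ℂ] H).reApplyInnerSelf z =
      ∑ i, ‖inner ℂ (u i) z‖ ^ 2 := by
    intro z
    rw [ContinuousLinearMap.reApplyInnerSelf_apply]
    simp only [sum_apply, sum_inner, rankOne_apply, inner_smul_left, map_sum, RCLike.conj_mul]
    norm_cast
  rw [hre, hre, ← Finset.sum_add_distrib, sum_apply, inner_sum]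
  refine (mul_le_mul_of_nonneg_left (norm_sum_le _ _) zero_le_two).trans ?_
  rw [Finset.mul_sum]
  refine Finset.sum_le_sum fun i _ => ?_
  rw [rankOne_apply, inner_smul_right, norm_mul, norm_inner_symm f]
  nlinarith [sq_nonneg (‖inner ℂ (u i) f‖ - ‖inner ℂ (u i) g‖)]

theorem finite_spectrum (a : H →L[ℂ] H) : (spectrum ℂ a).Finite := by
  refine (End.finite_spectrum (a : H →ₗ[ℂ] H)).subset fun z hz => ?_
  rw [spectrum.mem_iff] at hz ⊢
  rw [ContinuousLinearMap.isUnit_iff_isUnit_toLinearMap] at hz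
  exact hz

/-- A unitary is a combination, with coefficients of modulus one, of positive operators with
sum one, namely of its spectral projections. -/
theorem exists_sum_isPositive_of_mem_unitary {w : H →L[ℂ] H} (hw : w ∈ unitary (H →L[ℂ] H)) :
    ∃ (s : Finset ℂ) (P : ℂ → H →L[ℂ] H), (∀ z ∈ s, ‖z‖ = 1) ∧ (∀ z, (P z).IsPositive) ∧
      ∑ z ∈ s, P z = 1 ∧ ∑ z ∈ s, z • P z = w := by
  have hN : IsStarNormal w := ⟨by
    rw [Unitary.mem_iff] at hw
    rw [commute_iff_eq, hw.1, hw.2]⟩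
  have hfin := finite_spectrum w
  have hc : ∀ f : ℂ → ℂ, ContinuousOn f (spectrum ℂ w) := fun f => hfin.continuousOn f
  -- indicators of points are continuous on the finite spectrum, and define the projections
  let χ : ℂ → ℂ → ℂ := fun z x => if x = z then 1 else 0
  refine ⟨hfin.toFinset, fun z => cfc (χ z) w, fun z hz => ?_, fun z => ?_, ?_, ?_⟩
  · have := spectrum.subset_circle_of_unitary hw ((Set.Finite.mem_toFinset _).1 hz)
    simpa using this
  · have hsq : χ z = fun x => star (χ z x) * χ z x := by
      ext x
      by_cases h : x = z <;> simp [χ, h]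
    rw [← ContinuousLinearMap.nonneg_iff_isPositive]
    change 0 ≤ cfc (χ z) w
    rw [hsq, cfc_mul _ _ w (hc _) (hc _), cfc_star]
    exact star_mul_self_nonneg _
  · rw [← cfc_sum _ _ _ (fun _ _ => hc _), ← cfc_one ℂ w]
    refine cfc_congr fun x hx => ?_
    simp [χ, Finset.sum_apply, hx]
  · have h1 : ∀ z ∈ hfin.toFinset, z • cfc (χ z) w = cfc (fun x => z • χ z x) w := fun z _ =>
      (cfc_smul z _ w (hc _)).symm
    rw [Finset.sum_congr rfl h1, ← cfc_sum _ _ _ (fun _ _ => hc _)]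
    conv_rhs => rw [← cfc_id ℂ w]
    refine cfc_congr fun x hx => ?_
    simp [χ, Finset.sum_apply, hx]

theorem sum_smul_rankOne_mul {H : Type*} [NormedAddCommGroup H] [InnerProductSpace ℂ H]
    {ι : Type*} [Fintype ι] (x z : ι → H) (y : OrthonormalBasis ι ℂ H)
    (a b : ι → ℂ) :
    (∑ i, a i • rankOne ℂ (x i) (y i) : H →L[ℂ] H) * ∑ i, b i • rankOne ℂ (y i) (z i) =
      ∑ i, (a i * b i) • rankOne ℂ (x i) (z i) := by
  classical
  simp only [Finset.sum_mul, Finset.mul_sum, smul_mul_smul_comm, ContinuousLinearMap.mul_def,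
    rankOne_comp_rankOne, orthonormal_iff_ite.1 y.orthonormal]
  simp

/-- A contraction is the mean of two unitaries: in a singular value decomposition, each singular
value `cos θ` is the mean of `exp (i θ)` and `exp (-i θ)`. -/
theorem exists_unitary_add_eq_two_smul {a : H →L[ℂ] H} (ha : ‖a‖ ≤ 1) :
    ∃ w₁ ∈ unitary (H →L[ℂ] H), ∃ w₂ ∈ unitary (H →L[ℂ] H), w₁ + w₂ = (2 : ℂ) • a := by
  obtain ⟨u, v, h⟩ := exists_orthonormalBasis_apply_eq_singularValues_smul a
  set s : Fin (finrank ℂ H) → ℝ := fun i => (a : H →ₗ[ℂ] H).singularValues i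
  have hs0 : ∀ i, 0 ≤ s i := fun i => LinearMap.singularValues_nonneg _ _
  have hs1 : ∀ i, s i ≤ 1 := fun i => by
    have := (a.le_opNorm (v i)).trans (mul_le_of_le_one_left (norm_nonneg _) ha)
    rw [h, norm_smul, u.norm_eq_one, v.norm_eq_one, mul_one, Complex.norm_real] at this
    exact (le_abs_self _).trans this
  -- changing the singular values to phases turns `a` into a unitary
  have key : ∀ c : Fin (finrank ℂ H) → ℂ, (∀ i, ‖c i‖ = 1) →
      (∑ i, c i • rankOne ℂ (u i) (v i) : H →L[ℂ] H) ∈ unitary (H →L[ℂ] H) := by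
    intro c hc
    have h1 : ∀ i, star (c i) * c i = 1 := fun i => by
      have := RCLike.conj_mul (c i)
      rw [hc i] at this
      simpa using this
    have h2 : ∀ i, c i * star (c i) = 1 := fun i => by rw [mul_comm, h1]
    have hst : star (∑ i, c i • rankOne ℂ (u i) (v i) : H →L[ℂ] H) =
        ∑ i, star (c i) • rankOne ℂ (v i) (u i) := by
      simp [star_sum, ContinuousLinearMap.star_eq_adjoint]
    rw [Unitary.mem_iff, hst]
    simp only [sum_smul_rankOne_mul, h1, h2, one_smul, OrthonormalBasis.sum_rankOne_eq_id]
    exact ⟨rfl, rfl⟩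
  set θ : Fin (finrank ℂ H) → ℝ := fun i => Real.arccos (s i)
  refine ⟨_, key (fun i => Complex.exp (θ i * Complex.I)) fun i => Complex.norm_exp_ofReal_mul_I _,
    _, key (fun i => Complex.exp ((-θ i : ℝ) * Complex.I))
      fun i => Complex.norm_exp_ofReal_mul_I _, ?_⟩
  rw [← Finset.sum_add_distrib, eq_sum_rankOne v a, Finset.smul_sum]
  refine Finset.sum_congr rfl fun i _ => ?_
  rw [← add_smul, h, map_smul, smul_apply, smul_smul]
  congr 1
  have : ((s i : ℝ) : ℂ) = Complex.cos (θ i) := by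
    rw [← Complex.ofReal_cos, Real.cos_arccos (by linarith [hs0 i]) (hs1 i)]
  change _ = 2 * ((s i : ℝ) : ℂ)
  rw [this, Complex.two_cos]
  simp

/-- The Russo–Dye theorem for positive unital maps on matrices. -/
theorem norm_le_one_of_mem_unitalPositiveMaps {φ : (H →L[ℂ] H) →L[ℂ] (H →L[ℂ] H)}
    (hφ : φ ∈ unitalPositiveMaps H) : ‖φ‖ ≤ 1 := by
  obtain ⟨hpos, hone⟩ := hφ
  have hU : ∀ w ∈ unitary (H →L[ℂ] H), ∀ f g : H,
      2 * ‖inner ℂ f (φ w g)‖ ≤ ‖f‖ ^ 2 + ‖g‖ ^ 2 := by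
    intro w hw f g
    obtain ⟨s, P, hs, hP, hsum, rfl⟩ := exists_sum_isPositive_of_mem_unitary hw
    have hre : ∀ z : H, ∑ c ∈ s, (φ (P c)).reApplyInnerSelf z = ‖z‖ ^ 2 := by
      intro z
      simp only [ContinuousLinearMap.reApplyInnerSelf_apply]
      rw [← map_sum, ← sum_inner, ← sum_apply, ← map_sum, hsum, hone]
      exact inner_self_eq_norm_sq z
    rw [← hre f, ← hre g, ← Finset.sum_add_distrib, map_sum, sum_apply, inner_sum]
    refine (mul_le_mul_of_nonneg_left (norm_sum_le _ _) zero_le_two).trans ?_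
    rw [Finset.mul_sum]
    refine Finset.sum_le_sum fun c hc => ?_
    rw [map_smul, smul_apply, inner_smul_right, norm_mul, hs c hc, one_mul]
    exact two_mul_norm_inner_le_of_isPositive (hpos _ (hP c)) f g
  have hC : ∀ a : H →L[ℂ] H, ‖a‖ ≤ 1 → ‖φ a‖ ≤ 1 := by
    intro a ha
    obtain ⟨w₁, h₁, w₂, h₂, hw⟩ := exists_unitary_add_eq_two_smul ha
    refine ContinuousLinearMap.opNorm_le_bound _ zero_le_one fun g => ?_
    -- the choice `f = φ a g` makes the left side `‖φ a g‖ ^ 2`, so no rescaling of `f` is needed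
    set f := φ a g
    have h3 : inner ℂ f (φ w₁ g) + inner ℂ f (φ w₂ g) = 2 * inner ℂ f f := by
      rw [← inner_add_right, ← add_apply, ← map_add, hw, map_smul,
        smul_apply, inner_smul_right]
    have h4 : 2 * ‖f‖ ^ 2 ≤ ‖inner ℂ f (φ w₁ g)‖ + ‖inner ℂ f (φ w₂ g)‖ := by
      refine le_trans (le_of_eq ?_) (norm_add_le _ _)
      rw [h3, norm_mul, inner_self_eq_norm_sq_to_K]
      simp
    have h5 : ‖f‖ ^ 2 ≤ ‖g‖ ^ 2 := by linarith [hU w₁ h₁ f g, hU w₂ h₂ f g]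
    rw [one_mul]
    exact abs_le_of_sq_le_sq' h5 (norm_nonneg g) |>.2
  refine ContinuousLinearMap.opNorm_le_of_unit_norm (𝕜 := ℂ) zero_le_one fun a ha => hC a ha.le

end RussoDye

/-! ### Transposition -/

section Transpose

variable {H : Type*} [NormedAddCommGroup H] [InnerProductSpace ℂ H]
variable {ι : Type*} [Fintype ι]

/-- The complex conjugate of a vector, coordinatewise in an orthonormal basis. -/
noncomputable def conjVec (e : OrthonormalBasis ι ℂ H) (x : H) : H :=
  e.repr.symm (WithLp.toLp 2 (star (e.repr x).ofLp))

theorem repr_conjVec (e : OrthonormalBasis ι ℂ H) (x : H) :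
    (e.repr (conjVec e x)).ofLp = star (e.repr x).ofLp := by
  simp [conjVec]

@[simp]
theorem conjVec_conjVec (e : OrthonormalBasis ι ℂ H) (x : H) : conjVec e (conjVec e x) = x := by
  apply e.repr.injective
  apply WithLp.ofLp_injective
  rw [repr_conjVec, repr_conjVec, star_star]

@[simp]
theorem norm_conjVec (e : OrthonormalBasis ι ℂ H) (x : H) : ‖conjVec e x‖ = ‖x‖ := by
  rw [← e.repr.norm_map (conjVec e x), ← e.repr.norm_map x, EuclideanSpace.norm_eq,
    EuclideanSpace.norm_eq, repr_conjVec]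
  simp

variable [DecidableEq ι]

theorem toMatrix_transposeOp (e : OrthonormalBasis ι ℂ H) (b : H →L[ℂ] H) :
    LinearMap.toMatrix e.toBasis e.toBasis (transposeOp e b) =
      (LinearMap.toMatrix e.toBasis e.toBasis (b : H →ₗ[ℂ] H)).transpose :=
  LinearMap.toMatrix_toLin _ _ _

theorem trace_transposeOp_comp (e : OrthonormalBasis ι ℂ H) (x b : H →L[ℂ] H) :
    LinearMap.trace ℂ H (transposeOp e x ∘ₗ (b : H →ₗ[ℂ] H)) =
      LinearMap.trace ℂ H ((x : H →ₗ[ℂ] H) ∘ₗ transposeOp e b) := by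
  simp only [LinearMap.trace_eq_matrix_trace ℂ e.toBasis, LinearMap.toMatrix_comp _ e.toBasis,
    toMatrix_transposeOp]
  rw [← Matrix.trace_transpose, Matrix.transpose_mul, Matrix.transpose_transpose,
    Matrix.trace_mul_comm]

theorem transposeOp_one (e : OrthonormalBasis ι ℂ H) :
    transposeOp e (1 : H →L[ℂ] H) = LinearMap.id := by
  apply (LinearMap.toMatrix e.toBasis e.toBasis).injective
  rw [toMatrix_transposeOp]
  change (LinearMap.toMatrix e.toBasis e.toBasis LinearMap.id).transpose = _
  rw [LinearMap.toMatrix_id, Matrix.transpose_one]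

variable [FiniteDimensional ℂ H]

/-- Transposition as a linear map on `B(H)`. -/
noncomputable def transposeL (e : OrthonormalBasis ι ℂ H) : (H →L[ℂ] H) →ₗ[ℂ] (H →L[ℂ] H) where
  toFun b := (transposeOp e b).toContinuousLinearMap
  map_add' a b := by simp [transposeOp]
  map_smul' c a := by simp [transposeOp]

@[simp]
theorem coe_transposeL (e : OrthonormalBasis ι ℂ H) (b : H →L[ℂ] H) :
    (transposeL e b : H →ₗ[ℂ] H) = transposeOp e b := rfl

theorem transposeL_rankOne (e : OrthonormalBasis ι ℂ H) (x y : H) :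
    transposeL e (rankOne ℂ x y) = rankOne ℂ (conjVec e y) (conjVec e x) := by
  apply ContinuousLinearMap.coe_injective
  apply (LinearMap.toMatrix e.toBasis e.toBasis).injective
  rw [coe_transposeL, toMatrix_transposeOp, toMatrix_rankOne, toMatrix_rankOne]
  simp only [repr_conjVec, star_star]
  ext i j
  simp [Matrix.vecMulVec_apply, mul_comm, repr_conjVec]

/-- Transposition does not increase the trace norm, because it swaps and conjugates the left and
right singular vectors. -/
theorem traceNorm_transposeL_le (e : OrthonormalBasis ι ℂ H) (b : H →L[ℂ] H) :
    traceNorm (transposeL e b) ≤ traceNorm b := by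
  obtain ⟨u, v, h⟩ := exists_orthonormalBasis_apply_eq_singularValues_smul b
  have hb := eq_sum_rankOne v b
  have ht : transposeL e b = ∑ i, rankOne ℂ (conjVec e (v i)) (conjVec e (b (v i))) := by
    conv_lhs => rw [hb]
    rw [map_sum]
    exact Finset.sum_congr rfl fun i _ => transposeL_rankOne e _ _
  rw [ht, traceNorm_eq_sum_fin b]
  refine (traceNorm_sum_rankOne_le _ _ _).trans (Finset.sum_le_sum fun i _ => ?_)
  rw [norm_conjVec, norm_conjVec, h, norm_smul, u.norm_eq_one, v.norm_eq_one, mul_one, one_mul,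
    Complex.norm_real, Real.norm_eq_abs, abs_of_nonneg (LinearMap.singularValues_nonneg _ _)]

end Transpose

/-! ### Operators on the tensor square -/

section TensorSquare

variable {H : Type*} [NormedAddCommGroup H] [InnerProductSpace ℂ H]

theorem opTensor_add_right (a b c : H →L[ℂ] H) :
    opTensor a (b + c) = opTensor a b + opTensor a c := by
  simp [opTensor, TensorProduct.map_add_right]

theorem opTensor_smul_right (a b : H →L[ℂ] H) (c : ℂ) :
    opTensor a (c • b) = c • opTensor a b := by
  simp [opTensor, TensorProduct.map_smul_right]

theorem eq_sum_sum_smul_rankOne {ι : Type*} [Fintype ι] (e : OrthonormalBasis ι ℂ H)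
    (a : H →L[ℂ] H) :
    a = ∑ i, ∑ j, inner ℂ (e i) (a (e j)) • rankOne ℂ (e i) (e j) := by
  conv_lhs => rw [eq_sum_rankOne e a]
  rw [Finset.sum_comm]
  refine Finset.sum_congr rfl fun j _ => ?_
  conv_lhs => rw [← e.sum_repr' (a (e j))]
  simp [map_sum]

variable [FiniteDimensional ℂ H]

theorem trace_opTensor_mul_opTensor (a b c d : H →L[ℂ] H) :
    LinearMap.trace ℂ (H ⊗[ℂ] H) (opTensor a b * opTensor c d) =
      LinearMap.trace ℂ H ((a : H →ₗ[ℂ] H) ∘ₗ (c : H →ₗ[ℂ] H)) *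
        LinearMap.trace ℂ H ((b : H →ₗ[ℂ] H) ∘ₗ (d : H →ₗ[ℂ] H)) := by
  rw [← LinearMap.trace_tensorProduct', TensorProduct.map_comp]
  rfl

/-- The vector state of a product vector as a trace against a product operator. -/
theorem trace_mul_opTensor_rankOne (ϱ : End ℂ (H ⊗[ℂ] H)) (f g : H) :
    LinearMap.trace ℂ (H ⊗[ℂ] H) (ϱ * opTensor (rankOne ℂ f f) (rankOne ℂ g g)) =
      inner ℂ (f ⊗ₜ[ℂ] g) (ϱ (f ⊗ₜ[ℂ] g)) := by
  have h : opTensor (rankOne ℂ f f) (rankOne ℂ g g) =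
      (rankOne ℂ (f ⊗ₜ[ℂ] g) (f ⊗ₜ[ℂ] g) : H ⊗[ℂ] H →L[ℂ] H ⊗[ℂ] H) := by
    refine TensorProduct.ext' fun x y => ?_
    simp [opTensor, TensorProduct.smul_tmul', smul_smul, mul_comm]
  rw [h]
  exact trace_rankOne_comp (LinearMap.toContinuousLinearMap ϱ) _ _

theorem projNorm_opTensor_le (a b : H →L[ℂ] H) : projNorm (opTensor a b) ≤ ‖a‖ * traceNorm b :=
  csInf_le ⟨0, fun _ hr => repValues_nonneg hr⟩
    ⟨1, fun _ => a, fun _ => b, by simp, by simp⟩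

theorem le_mul_projNorm {C t : ℝ} (hC : 0 ≤ C) {u : End ℂ (H ⊗[ℂ] H)}
    (h : ∀ r ∈ repValues u, t ≤ C * r) : t ≤ C * projNorm u := by
  rcases hC.eq_or_lt with rfl | h0
  · obtain ⟨r, hr⟩ := repValues_nonempty u
    simpa using h r hr
  · rw [← div_le_iff₀' h0]
    exact le_csInf (repValues_nonempty u) fun r hr => (div_le_iff₀' h0).2 (h r hr)

end TensorSquare

/-! ### The density matrix of a linear map -/

section Density

variable {H : Type*} [NormedAddCommGroup H] [InnerProductSpace ℂ H] [FiniteDimensional ℂ H]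
variable {ι : Type*} [Fintype ι] [DecidableEq ι]

/-- The density matrix `∑ i j, Eⱼᵢ ⊗ φ(Eᵢⱼ)ᵗ` of a linear map `φ`, where the `Eᵢⱼ` are the matrix
units of the basis `e`. -/
noncomputable def densityEnd (e : OrthonormalBasis ι ℂ H) :
    ((H →L[ℂ] H) →L[ℂ] (H →L[ℂ] H)) →ₗ[ℂ] End ℂ (H ⊗[ℂ] H) where
  toFun φ := ∑ i, ∑ j, opTensor (rankOne ℂ (e j) (e i))
    (transposeL e (φ (rankOne ℂ (e i) (e j))))
  map_add' φ ψ := by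
    simp only [add_apply, map_add, opTensor_add_right, Finset.sum_add_distrib]
  map_smul' c φ := by
    simp only [smul_apply, map_smul, opTensor_smul_right, Finset.smul_sum, RingHom.id_apply]

/-- The density matrix of a linear map, as an element of `B(H) ⊗_α B(H)`. -/
noncomputable def density (e : OrthonormalBasis ι ℂ H) :
    ((H →L[ℂ] H) →L[ℂ] (H →L[ℂ] H)) →ₗ[ℂ] AlphaTensor H where
  toFun := densityEnd e
  map_add' := (densityEnd e).map_add
  map_smul' := (densityEnd e).map_smul

theorem trace_density_mul (e : OrthonormalBasis ι ℂ H) (φ : (H →L[ℂ] H) →L[ℂ] (H →L[ℂ] H))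
    (a b : H →L[ℂ] H) :
    LinearMap.trace ℂ (H ⊗[ℂ] H) ((density e φ).toEnd * opTensor a b) =
      LinearMap.trace ℂ H ((φ a : H →ₗ[ℂ] H) ∘ₗ transposeOp e b) := by
  have h1 : (density e φ).toEnd = ∑ i, ∑ j, opTensor (rankOne ℂ (e j) (e i))
    (transposeL e (φ (rankOne ℂ (e i) (e j)))) := rfl
  have h2 : φ a = ∑ i, ∑ j, inner ℂ (e i) (a (e j)) • φ (rankOne ℂ (e i) (e j)) := by
    conv_lhs => rw [eq_sum_sum_smul_rankOne e a]
    simp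
  rw [h1, h2]
  simp only [Finset.sum_mul, map_sum, ContinuousLinearMap.toLinearMap_sum,
    ← Module.End.mul_eq_comp, ContinuousLinearMap.toLinearMap_smul, smul_mul_assoc, map_smul]
  refine Finset.sum_congr rfl fun i _ => Finset.sum_congr rfl fun j _ => ?_
  rw [trace_opTensor_mul_opTensor, coe_transposeL, trace_transposeOp_comp,
    LinearMap.trace_comp_comm', trace_rankOne_comp]
  rfl

theorem trace_density_mul_rankOne (e : OrthonormalBasis ι ℂ H)
    (φ : (H →L[ℂ] H) →L[ℂ] (H →L[ℂ] H)) (a : H →L[ℂ] H) (f g : H) :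
    LinearMap.trace ℂ (H ⊗[ℂ] H) ((density e φ).toEnd * opTensor a (rankOne ℂ f g)) =
      inner ℂ (conjVec e f) (φ a (conjVec e g)) := by
  rw [trace_density_mul, ← coe_transposeL, transposeL_rankOne, trace_rankOne_comp]

/-- The isometry is the duality between the operator norm and the trace norm. -/
theorem norm_density (e : OrthonormalBasis ι ℂ H) (φ : (H →L[ℂ] H) →L[ℂ] (H →L[ℂ] H)) :
    ‖density e φ‖ = ‖φ‖ := by
  change alphaNorm (density e φ).toEnd = ‖φ‖
  refine le_antisymm (alphaNorm_le (norm_nonneg φ) fun u => ?_) ?_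
  · refine le_mul_projNorm (norm_nonneg φ) ?_
    rintro r ⟨k, x, y, rfl, rfl⟩
    rw [Finset.mul_sum, Finset.mul_sum, map_sum]
    refine (norm_sum_le _ _).trans (Finset.sum_le_sum fun i _ => ?_)
    rw [trace_density_mul, ← mul_assoc]
    exact (norm_trace_comp_le (φ (x i)) (transposeL e (y i))).trans
      (mul_le_mul (φ.le_opNorm _) (traceNorm_transposeL_le e _) (traceNorm_nonneg _)
        (by positivity))
  · have h0 := alphaNorm_nonneg (density e φ).toEnd
    refine ContinuousLinearMap.opNorm_le_bound _ h0 fun a => ?_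
    refine ContinuousLinearMap.opNorm_le_bound _ (by positivity) fun g => ?_
    -- `φ a` is tested on the rank-one operator whose transpose is `|g⟩⟨φ a g|`
    have hrank : traceNorm (rankOne ℂ (conjVec e (φ a g)) (conjVec e g)) ≤ ‖φ a g‖ * ‖g‖ := by
      simpa using traceNorm_sum_rankOne_le {()} (fun _ => conjVec e (φ a g)) fun _ => conjVec e g
    have h1 : ‖φ a g‖ * ‖φ a g‖ ≤
        ‖φ a g‖ * (alphaNorm (density e φ).toEnd * ‖a‖ * ‖g‖) := by
      have h2 := norm_trace_le (density e φ).toEnd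
        (opTensor a (rankOne ℂ (conjVec e (φ a g)) (conjVec e g)))
      rw [trace_density_mul_rankOne, conjVec_conjVec, conjVec_conjVec,
        inner_self_eq_norm_sq_to_K] at h2
      calc ‖φ a g‖ * ‖φ a g‖ = ‖((‖φ a g‖ : ℂ)) ^ 2‖ := by simp [pow_two]
        _ ≤ _ := h2
        _ ≤ alphaNorm (density e φ).toEnd * (‖a‖ * (‖φ a g‖ * ‖g‖)) :=
          mul_le_mul_of_nonneg_left ((projNorm_opTensor_le _ _).trans
            (mul_le_mul_of_nonneg_left hrank (norm_nonneg a))) h0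
        _ = _ := by ring
    rcases (norm_nonneg (φ a g)).eq_or_lt with h | h
    · rw [← h]
      positivity
    · exact le_of_mul_le_mul_left h1 h

theorem finrank_maps_eq_finrank_alphaTensor :
    finrank ℂ ((H →L[ℂ] H) →L[ℂ] (H →L[ℂ] H)) = finrank ℂ (AlphaTensor H) := by
  have h1 : finrank ℂ (H →L[ℂ] H) = finrank ℂ H * finrank ℂ H := by
    rw [← (LinearMap.toContinuousLinearMap (𝕜 := ℂ) (E := H) (F' := H)).finrank_eq,
      finrank_linearMap]
  have h2 : finrank ℂ (AlphaTensor H) = finrank ℂ (End ℂ (H ⊗[ℂ] H)) := rfl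
  rw [h2, finrank_linearMap, finrank_tensorProduct, ← (LinearMap.toContinuousLinearMap (𝕜 := ℂ)
    (E := H →L[ℂ] H) (F' := H →L[ℂ] H)).finrank_eq, finrank_linearMap, h1]

instance : FiniteDimensional ℂ (AlphaTensor H) :=
  inferInstanceAs (FiniteDimensional ℂ (End ℂ (H ⊗[ℂ] H)))

theorem density_injective (e : OrthonormalBasis ι ℂ H) : Function.Injective (density e) := by
  intro φ ψ h
  have h0 : density e (φ - ψ) = 0 := by
    rw [LinearMap.map_sub, h]
    exact sub_self (density e ψ)
  have h1 := norm_density e (φ - ψ)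
  rw [h0, norm_zero] at h1
  exact sub_eq_zero.1 (norm_eq_zero.1 h1.symm)

/-- The density matrix as an isometric isomorphism. -/
noncomputable def densityEquiv (e : OrthonormalBasis ι ℂ H) :
    ((H →L[ℂ] H) →L[ℂ] (H →L[ℂ] H)) ≃ₗᵢ[ℂ] AlphaTensor H where
  toLinearEquiv := LinearMap.linearEquivOfInjective (density e) (density_injective e)
    finrank_maps_eq_finrank_alphaTensor
  norm_map' := norm_density e

theorem densityEquiv_apply (e : OrthonormalBasis ι ℂ H)
    (φ : (H →L[ℂ] H) →L[ℂ] (H →L[ℂ] H)) : densityEquiv e φ = density e φ := rfl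

end Density

/-! ### Unital positive maps and normalized block-positive density matrices -/

section Positivity

variable {H : Type*} [NormedAddCommGroup H] [InnerProductSpace ℂ H]

theorem isPositive_of_forall_inner_nonneg {A : H →L[ℂ] H} (h : ∀ g, 0 ≤ inner ℂ g (A g)) :
    A.IsPositive := by
  rw [ContinuousLinearMap.isPositive_iff_complex]
  intro g
  have h1 := Complex.nonneg_iff.1 (h g)
  have h2 : inner ℂ (A g) g = inner ℂ g (A g) := by
    rw [← inner_conj_symm, Complex.conj_eq_iff_im]
    exact h1.2.symm
  rw [h2]
  exact ⟨Complex.ext rfl (by simpa using h1.2), h1.1⟩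

variable [FiniteDimensional ℂ H] {ι : Type*} [Fintype ι] [DecidableEq ι]

theorem inner_tmul_density (e : OrthonormalBasis ι ℂ H)
    (φ : (H →L[ℂ] H) →L[ℂ] (H →L[ℂ] H)) (f g : H) :
    inner ℂ (f ⊗ₜ[ℂ] g) ((density e φ).toEnd (f ⊗ₜ[ℂ] g)) =
      inner ℂ (conjVec e g) (φ (rankOne ℂ f f) (conjVec e g)) := by
  rw [← trace_mul_opTensor_rankOne, trace_density_mul_rankOne]

theorem isBlockPositive_density_iff (e : OrthonormalBasis ι ℂ H)
    (φ : (H →L[ℂ] H) →L[ℂ] (H →L[ℂ] H)) :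
    IsBlockPositive (density e φ) ↔ ∀ a : H →L[ℂ] H, a.IsPositive → (φ a).IsPositive := by
  refine ⟨fun h a ha => ?_, fun h f g => ?_⟩
  · obtain ⟨m, u, rfl⟩ := ContinuousLinearMap.isPositive_iff_eq_sum_rankOne.1 ha
    rw [map_sum]
    refine ContinuousLinearMap.isPositive_sum _ fun i _ =>
      isPositive_of_forall_inner_nonneg fun g => ?_
    have := h (u i) (conjVec e g)
    rwa [inner_tmul_density, conjVec_conjVec] at this
  · rw [inner_tmul_density]
    exact (h _ (isPositive_rankOne_self f)).inner_nonneg_right _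

/-- An operator on `H ⊗ H` with vanishing expectation at all product vectors is zero, since the
associated map vanishes on the rank-one positive operators, which span `B(H)`. -/
theorem eq_zero_of_forall_inner_tmul_eq_zero {ϱ : AlphaTensor H}
    (h : ∀ f g : H, inner ℂ (f ⊗ₜ[ℂ] g) (ϱ.toEnd (f ⊗ₜ[ℂ] g)) = 0) : ϱ = 0 := by
  set e := stdOrthonormalBasis ℂ H
  obtain ⟨φ, rfl⟩ := (densityEquiv e).surjective ϱ
  suffices φ = 0 by rw [this, densityEquiv_apply, LinearMap.map_zero]
  have h1 : ∀ f : H, φ (rankOne ℂ f f) = 0 := by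
    intro f
    apply ContinuousLinearMap.coe_injective
    refine (inner_map_self_eq_zero _).1 fun g => ?_
    have := h f (conjVec e g)
    rw [densityEquiv_apply, inner_tmul_density, conjVec_conjVec] at this
    rw [← inner_conj_symm]
    exact (congrArg _ this).trans (map_zero _)
  ext1 a
  have ha : a ∈ Submodule.span ℂ {a : H →L[ℂ] H | 0 ≤ a} := by
    rw [CStarAlgebra.span_nonneg]
    trivial
  induction ha using Submodule.span_induction with
  | mem a ha =>
    obtain ⟨m, u, rfl⟩ := ContinuousLinearMap.isPositive_iff_eq_sum_rankOne.1
      ((ContinuousLinearMap.nonneg_iff_isPositive a).1 ha)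
    simp [h1]
  | zero => simp
  | add a b _ _ ha hb => simpa using congrArg₂ (· + ·) ha hb
  | smul c a _ ha => simpa using Or.inr ha

/-- Block-positive operators are self-adjoint. -/
theorem IsBlockPositive.adjoint_eq {ϱ : AlphaTensor H} (h : IsBlockPositive ϱ) :
    ϱ.toEnd.adjoint = ϱ.toEnd := by
  have h0 : (show AlphaTensor H from ϱ.toEnd.adjoint - ϱ.toEnd) = 0 := by
    refine eq_zero_of_forall_inner_tmul_eq_zero fun f g => ?_
    change inner ℂ (f ⊗ₜ[ℂ] g) ((ϱ.toEnd.adjoint - ϱ.toEnd) (f ⊗ₜ[ℂ] g)) = 0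
    rw [LinearMap.sub_apply, inner_sub_right, LinearMap.adjoint_inner_right, ← inner_conj_symm,
      sub_eq_zero, Complex.conj_eq_iff_im]
    exact (Complex.nonneg_iff.1 (h f g)).2.symm
  exact sub_eq_zero.1 h0

theorem tr_density (e : OrthonormalBasis ι ℂ H) (φ : (H →L[ℂ] H) →L[ℂ] (H →L[ℂ] H)) :
    tr (density e φ) = LinearMap.trace ℂ H (φ 1 : H →ₗ[ℂ] H) := by
  have h : opTensor (1 : H →L[ℂ] H) 1 = 1 := TensorProduct.map_id
  rw [← LinearMap.comp_id (φ 1 : H →ₗ[ℂ] H), ← transposeOp_one e, ← trace_density_mul, h, mul_one]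
  rfl

theorem eq_zero_of_isPositive_of_trace_eq_zero {A : H →L[ℂ] H} (hA : A.IsPositive)
    (h : LinearMap.trace ℂ H (A : H →ₗ[ℂ] H) = 0) : A = 0 := by
  obtain ⟨m, u, rfl⟩ := ContinuousLinearMap.isPositive_iff_eq_sum_rankOne.1 hA
  simp only [ContinuousLinearMap.toLinearMap_sum, map_sum, trace_rankOne,
    inner_self_eq_norm_sq_to_K] at h
  have h2 : ∑ i, ‖u i‖ ^ 2 = 0 := by
    have h3 : ((∑ i, ‖u i‖ ^ 2 : ℝ) : ℂ) = 0 := by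
      push_cast
      exact h
    exact_mod_cast h3
  rw [Finset.sum_eq_zero_iff_of_nonneg fun i _ => by positivity] at h2
  refine Finset.sum_eq_zero fun i hi => ?_
  have : u i = 0 := by simpa using h2 i hi
  simp [this]

/-- A positive contraction whose trace is the dimension is the identity. -/
theorem eq_one_of_isPositive_of_trace_eq_finrank {A : H →L[ℂ] H} (hA : A.IsPositive)
    (hn : ‖A‖ ≤ 1) (h : LinearMap.trace ℂ H (A : H →ₗ[ℂ] H) = finrank ℂ H) : A = 1 := by
  -- `1 - A` is positive and has trace zero
  have hpos : (1 - A).IsPositive := by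
    refine isPositive_of_forall_inner_nonneg fun g => ?_
    have h1 := hA.inner_nonneg_right g
    have h2 := Complex.nonneg_iff.1 h1
    have h3 : (inner ℂ g (A g)).re ≤ ‖g‖ ^ 2 := by
      refine (Complex.re_le_norm _).trans ((norm_inner_le_norm _ _).trans ?_)
      rw [pow_two]
      gcongr
      exact (A.le_opNorm g).trans (mul_le_of_le_one_left (norm_nonneg g) hn)
    have h4 : inner ℂ g ((1 - A) g) = ((‖g‖ ^ 2 : ℝ) : ℂ) - inner ℂ g (A g) := by
      rw [sub_apply, inner_sub_right, one_apply_eq_self, inner_self_eq_norm_sq_to_K]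
      push_cast
      rfl
    rw [h4, Complex.nonneg_iff, Complex.sub_re, Complex.sub_im, Complex.ofReal_re,
      Complex.ofReal_im, ← h2.2]
    exact ⟨by linarith, by simp⟩
  refine (sub_eq_zero.1 (eq_zero_of_isPositive_of_trace_eq_zero hpos ?_)).symm
  rw [ContinuousLinearMap.toLinearMap_sub, map_sub, h, sub_eq_zero]
  exact LinearMap.trace_one ℂ H

theorem density_mem_normalizedBP_iff [Nontrivial H] (e : OrthonormalBasis ι ℂ H)
    (φ : (H →L[ℂ] H) →L[ℂ] (H →L[ℂ] H)) :
    density e φ ∈ normalizedBP H ↔ φ ∈ unitalPositiveMaps H := by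
  constructor
  · rintro ⟨hn, -, hbp, htr⟩
    rw [norm_density] at hn
    rw [isBlockPositive_density_iff] at hbp
    rw [tr_density] at htr
    refine ⟨hbp, eq_one_of_isPositive_of_trace_eq_finrank
      (hbp 1 ContinuousLinearMap.isPositive_one) ?_ htr⟩
    simpa [hn] using φ.le_opNorm 1
  · intro h
    have hbp := (isBlockPositive_density_iff e φ).2 h.1
    refine ⟨?_, hbp.adjoint_eq, hbp, ?_⟩
    · rw [norm_density]
      refine le_antisymm (norm_le_one_of_mem_unitalPositiveMaps h) ?_
      simpa [h.2] using φ.le_opNorm 1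
    · rw [tr_density, h.2]
      exact LinearMap.trace_one ℂ H

end Positivity

end PosMaps

theorem mainTheorem2 {H : Type*} [NormedAddCommGroup H] [InnerProductSpace ℂ H]
    [FiniteDimensional ℂ H] [Nontrivial H]
    {ι : Type*} [Fintype ι] [DecidableEq ι] (e : OrthonormalBasis ι ℂ H) :
    -- strongly non-smooth, not rotund, block-positive points of the unit sphere with trace `n`
    -- are exposed points of the set of normalized block-positive density matrices
    (∀ σ : alphaSelfAdjoint H,
      ‖σ‖ = 1 → IsStronglyNonSmoothPoint σ → ¬ IsRotundPoint σ →
      IsBlockPositive (σ : AlphaTensor H) → tr (σ : AlphaTensor H) = Module.finrank ℂ H →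
      σ ∈ Set.exposedPoints ℝ
        ((fun ϱ : alphaSelfAdjoint H => (ϱ : AlphaTensor H)) ⁻¹' normalizedBP H)) ∧
    -- the isometric isomorphism with the unital positive maps
    ∃ Φ : ((H →L[ℂ] H) →L[ℂ] (H →L[ℂ] H)) ≃ₗᵢ[ℂ] AlphaTensor H,
      (∀ (φ : (H →L[ℂ] H) →L[ℂ] (H →L[ℂ] H)) (a b : H →L[ℂ] H),
        LinearMap.trace ℂ (H ⊗[ℂ] H) ((Φ φ).toEnd * opTensor a b) =
          LinearMap.trace ℂ H ((φ a : H →ₗ[ℂ] H) ∘ₗ transposeOp e b)) ∧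
      Φ '' unitalPositiveMaps H = normalizedBP H := by
  refine ⟨fun σ hσ hns _ hbp htr => ?_, densityEquiv e, trace_density_mul e, ?_⟩
  · have : FiniteDimensional ℝ (AlphaTensor H) := FiniteDimensional.complexToReal (AlphaTensor H)
    obtain ⟨l, hl, hexp⟩ := hns.exists_exposing
    refine ⟨⟨hσ, σ.2, hbp, htr⟩, l, fun ϱ hϱ => ?_⟩
    obtain ⟨h1, h2⟩ := hexp ϱ hϱ.1.le
    rw [hl]
    exact ⟨h1, fun h => h2 (le_antisymm h1 h)⟩
  · ext ϱ
    obtain ⟨φ, rfl⟩ := (densityEquiv e).surjective ϱ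
    rw [(densityEquiv e).injective.mem_set_image, densityEquiv_apply,
      density_mem_normalizedBP_iff]
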